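/- Let $p$ be a prime number. A finite groupoid is a groupoid with a finite set of morphisms; let $\widehat{\mathbf{G}}$ be the pro-category of the category of finite groupoids and functors (finite groupoids are viewed as constant pro-objects). For a finite group $G$ and a finite set $S$ with a right action of $G$, let $S/\!/G$ be the groupoid with set of objects $S$ in which the morphisms from $s$ to $s'$ are the elements $g\in G$ with $s\cdot g=s'$. Let $*$ be the one-point groupoid, $\mathbb{Z}/p/\!/\mathbb{Z}/p$ the groupoid of the translation action, $*/\!/\mathbb{Z}/p$ the groupoid of the trivial action on a point, and let $\underline{\mathbb{Z}/p}$ be the set $\mathbb{Z}/p$ viewed as a groupoid with only identity morphisms. For a finite groupoid $C$, let $H^0(C,\mathbb{Z}/p)$ be the group of functions $\mathrm{Ob}(C)\to\mathbb{Z}/p$ which take the same value at the source and at the target of every morphism, and let $H^1(C,\mathbb{Z}/p)$ be the group of functions $c:\mathrm{Mor}(C)\to\mathbb{Z}/p$ sending composition to addition, modulo those of the form $(f:x\to y)\mapsto b(y)-b(x)$ with $b:\mathrm{Ob}(C)\to\mathbb{Z}/p$; for a pro-object $C=\{C_i\}_{i}$ put $H^n(C,\mathbb{Z}/p)=\operatorname{colim}_i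 H^n(C_i,\mathbb{Z}/p)$. Then $\widehat{\mathbf{G}}$ has all small limits and colimits, and there is a (closed) model structure on $\widehat{\mathbf{G}}$ such that: 1. the cofibrations are exactly the maps with the left lifting property against $\mathbb{Z}/p/\!/\mathbb{Z}/p\to *$; 2. the trivial cofibrations are exactly the maps with the left lifting property against the three maps $\mathbb{Z}/p/\!/\mathbb{Z}/p\to */\!/\mathbb{Z}/p$, $\;*/\!/\mathbb{Z}/p\to *$ and $0:*\to\underline{\mathbb{Z}/p}$; 3. the weak equivalences are exactly the maps $f:C\to D$ such that the induced maps $H^0(D,\mathbb{Z}/p)\to H^0(C,\mathbb{Z}/p)$ and $H^1(D,\mathbb{Z}/p)\to H^1(C,\mathbb{Z}/p)$ are isomorphisms. -/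

import Mathlib

universe w v u u'

open CategoryTheory HomotopicalAlgebra

namespace ProGrpd

/-! ### Pro-objects -/

section Pro

variable (C : Type u) [Category.{v} C]

/-- The pro-category of `C`: the opposite of the category of ind-objects of the opposite of `C`.
Its objects are the formal limits of small cofiltered diagrams in `C`. -/
abbrev Pro : Type (max u (v + 1)) := (Ind Cᵒᵖ)ᵒᵖ

variable {C}

/-- The fully faithful embedding of `C` in its pro-category, as constant pro-objects. -/
noncomputable abbrev Pro.const : C ⥤ Pro C := (Ind.yoneda (C := Cᵒᵖ)).rightOp

/-- The extension of a contravariant functor `F` on `C` to the pro-category: the value at a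
pro-object `X` is the (filtered) colimit of the groups `F K` over all the morphisms from `X` to
constant pro-objects `K`. If `X` is the formal cofiltered limit of `Xᵢ`, this is the colimit of
the groups `F Xᵢ`. -/
noncomputable def Pro.extend {C : Type (w + 1)} [Category.{w} C]
    (F : Cᵒᵖ ⥤ AddCommGrpCat.{w + 1}) : (Pro C)ᵒᵖ ⥤ AddCommGrpCat.{w + 1} :=
  (opOpEquivalence (Ind Cᵒᵖ)).functor ⋙
    Functor.pointwiseLeftKanExtension (Ind.yoneda (C := Cᵒᵖ)) F

end Pro

/-! ### Finite groupoids -/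

/-- The property of having a finite set of morphisms. -/
def IsFiniteGrpd : ObjectProperty Grpd.{w, w} := fun C => Finite (Arrow C)

/-- The category of finite groupoids (the morphisms are the functors). -/
abbrev FinGrpd : Type (w + 1) := IsFiniteGrpd.{w}.FullSubcategory

/-- A morphism of finite groupoids from a functor. -/
abbrev FinGrpd.ofFunctor {C D : FinGrpd.{w}} (F : C.obj ⥤ D.obj) : C ⟶ D :=
  ObjectProperty.homMk (X := C) (Y := D) F

lemma finite_arrow (C : Type w) [Category.{w} C] [Finite C] [∀ x y : C, Finite (x ⟶ y)] :
    Finite (Arrow C) :=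
  Finite.of_injective (β := Σ x y : C, (x ⟶ y)) (fun f => ⟨f.left, f.right, f.hom⟩) (by
    rintro ⟨x, y, f⟩ ⟨x', y', f'⟩ h
    simp only [Sigma.mk.injEq] at h
    obtain ⟨h₁, h₂⟩ := h
    subst h₁
    simp only [heq_eq_eq, Sigma.mk.injEq] at h₂
    obtain ⟨h₂, h₃⟩ := h₂
    subst h₂
    simp only [heq_eq_eq] at h₃
    subst h₃
    rfl)

/-- The set of objects of the groupoid `S // G`. -/
structure ActionGrpd (S : Type u) (G : Type u') where
  /-- The underlying element. -/
  pt : S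

namespace ActionGrpd

variable (S : Type w) (G : Type w) [Group G] [MulAction Gᵐᵒᵖ S]

/-- For a right action of `G` on `S`, the groupoid `S // G` with set of objects `S` and with
morphisms from `s` to `s'` the elements `g` of `G` such that `s.g = s'`. -/
instance : Groupoid.{w} (ActionGrpd S G) where
  Hom s s' := { g : G // MulOpposite.op g • s.pt = s'.pt }
  id s := ⟨1, by simp⟩
  comp {s s' s''} g h := ⟨g.1 * h.1, by rw [MulOpposite.op_mul, mul_smul, g.2, h.2]⟩
  id_comp g := Subtype.ext (one_mul g.1)
  comp_id g := Subtype.ext (mul_one g.1)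
  assoc f g h := Subtype.ext (mul_assoc f.1 g.1 h.1)
  inv {s s'} g := ⟨g.1⁻¹, by
    rw [MulOpposite.op_inv, inv_smul_eq_iff, g.2]⟩
  inv_comp g := Subtype.ext (inv_mul_cancel g.1)
  comp_inv g := Subtype.ext (mul_inv_cancel g.1)

instance [Finite S] : Finite (ActionGrpd S G) :=
  Finite.of_injective (fun s => s.pt) (by rintro ⟨s⟩ ⟨t⟩ h; exact congrArg _ h)

instance [Finite G] (s s' : ActionGrpd S G) : Finite (s ⟶ s') :=
  Finite.of_injective (fun g : s ⟶ s' => g.1) Subtype.val_injective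

/-- `S // G` as a finite groupoid. -/
def finGrpd [Finite S] [Finite G] : FinGrpd.{w} :=
  ⟨Grpd.of (ActionGrpd S G), finite_arrow (ActionGrpd S G)⟩

end ActionGrpd

/-- The cyclic group of order `p`, in multiplicative notation. -/
abbrev Cyc (p : ℕ) : Type w := ULift.{w} (Multiplicative (ZMod p))

section Generators

variable (p : ℕ) [NeZero p]

instance : Finite (Multiplicative (ZMod p)) := inferInstanceAs (Finite (ZMod p))

/-- The one-point groupoid `*`. -/
def point : FinGrpd.{w} :=
  ⟨Grpd.of (Discrete PUnit.{w + 1}), finite_arrow (Discrete PUnit.{w + 1})⟩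

/-- The set `ℤ/p`, seen as a groupoid with only identity morphisms. -/
def discreteCyc : FinGrpd.{w} :=
  ⟨Grpd.of (Discrete (Cyc.{w} p)), finite_arrow (Discrete (Cyc.{w} p))⟩

/-- The groupoid `ℤ/p // ℤ/p`, for the action of `ℤ/p` on itself by right translation. -/
def cycModCyc : FinGrpd.{w} := ActionGrpd.finGrpd (Cyc.{w} p) (Cyc.{w} p)

/-- The groupoid `* // ℤ/p`, with a single object with group of automorphisms `ℤ/p`. -/
def pointModCyc : FinGrpd.{w} := ActionGrpd.finGrpd PUnit.{w + 1} (Cyc.{w} p)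

/-- The map from a finite groupoid to the point. -/
def toPoint (C : FinGrpd.{w}) : C ⟶ point.{w} :=
  FinGrpd.ofFunctor ((Functor.const C.obj).obj (Discrete.mk PUnit.unit))

/-- The map `ℤ/p // ℤ/p → * // ℤ/p`, induced by the equivariant map `ℤ/p → *`. -/
def cycModCycToPointModCyc : cycModCyc.{w} p ⟶ pointModCyc.{w} p :=
  FinGrpd.ofFunctor (C := cycModCyc.{w} p) (D := pointModCyc.{w} p)
    { obj := fun _ => (⟨PUnit.unit⟩ : ActionGrpd PUnit.{w + 1} (Cyc.{w} p))
      map := fun {s s'} (g : { g : Cyc.{w} p // MulOpposite.op g •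
          (ActionGrpd.pt s : Cyc.{w} p) = ActionGrpd.pt s' }) => ⟨g.1, rfl⟩
      map_id := fun _ => rfl
      map_comp := fun _ _ => rfl }

/-- The map `* → ℤ/p` with image the neutral element. -/
def pointToDiscreteCyc : point.{w} ⟶ discreteCyc.{w} p :=
  FinGrpd.ofFunctor (C := point.{w}) (D := discreteCyc.{w} p)
    ((Functor.const (Discrete PUnit.{w + 1})).obj (Discrete.mk (1 : Cyc.{w} p)))

end Generators

/-! ### Cohomology of groupoids in degrees `0` and `1` -/

section Cohomology

variable (C : Type u) [Category.{v} C] (A : Type u') [AddCommGroup A]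

/-- `H⁰(C, A)`: the functions on the objects of `C` that take the same value at the source and
at the target of every morphism. -/
def H0 : AddSubgroup (C → A) where
  carrier := { a | ∀ ⦃x y : C⦄, (x ⟶ y) → a x = a y }
  zero_mem' := fun _ _ _ => rfl
  add_mem' := fun {a b} ha hb x y f => by simp only [Pi.add_apply, ha f, hb f]
  neg_mem' := fun {a} ha x y f => by simp only [Pi.neg_apply, ha f]

/-- `Z¹(C, A)`: the functions on the morphisms of `C` that send composition to addition. -/
def Z1 : AddSubgroup (∀ x y : C, (x ⟶ y) → A) where
  carrier := { c | ∀ ⦃x y z : C⦄ (f : x ⟶ y) (g : y ⟶ z), c x z (f ≫ g) = c x y f + c y z g }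
  zero_mem' := fun _ _ _ _ _ => by simp
  add_mem' := fun {a b} ha hb x y z f g => by
    simp only [Pi.add_apply, ha f g, hb f g]; abel
  neg_mem' := fun {a} ha x y z f g => by
    simp only [Pi.neg_apply, ha f g]; abel

/-- The coboundary of a function `b` on objects: it sends `f : x ⟶ y` to `b y - b x`. -/
def d0 : (C → A) →+ Z1 C A where
  toFun b := ⟨fun x y _ => b y - b x, fun x y z _ _ => by
    rw [add_comm]; exact (sub_add_sub_cancel (b z) (b y) (b x)).symm⟩
  map_zero' := by ext; simp
  map_add' a b := by
    ext x y f
    change (a + b) y - (a + b) x = (a y - a x) + (b y - b x)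
    simp only [Pi.add_apply]; abel

/-- `H¹(C, A)`: the cocycles modulo the coboundaries. -/
abbrev H1 : Type _ := Z1 C A ⧸ (d0 C A).range

variable {C} {D : Type u} [Category.{v} D]

/-- The map induced by a functor on `H⁰`. -/
def H0.map (F : C ⥤ D) : H0 D A →+ H0 C A where
  toFun a := ⟨fun x => a.1 (F.obj x), fun _ _ f => a.2 (F.map f)⟩
  map_zero' := rfl
  map_add' _ _ := rfl

/-- The map induced by a functor on `Z¹`. -/
def Z1.map (F : C ⥤ D) : Z1 D A →+ Z1 C A where
  toFun c := ⟨fun x y f => c.1 (F.obj x) (F.obj y) (F.map f), fun x y z f g => by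
    change c.1 _ _ (F.map (f ≫ g)) = _
    rw [F.map_comp]
    exact c.2 (F.map f) (F.map g)⟩
  map_zero' := rfl
  map_add' _ _ := rfl

/-- The map induced by a functor on `H¹`. -/
def H1.map (F : C ⥤ D) : H1 D A →+ H1 C A :=
  QuotientAddGroup.map _ _ (Z1.map A F) (by
    rintro _ ⟨b, rfl⟩
    exact ⟨fun x => b (F.obj x), rfl⟩)

/-- `H⁰(-, A)` as a contravariant functor on finite groupoids. -/
def H0Fin (A : Type (w + 1)) [AddCommGroup A] : FinGrpd.{w}ᵒᵖ ⥤ AddCommGrpCat.{w + 1} where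
  obj C := AddCommGrpCat.of (H0 C.unop.obj A)
  map F := AddCommGrpCat.ofHom (H0.map A F.unop.hom)
  map_id _ := rfl
  map_comp _ _ := rfl

/-- `H¹(-, A)` as a contravariant functor on finite groupoids. -/
def H1Fin (A : Type (w + 1)) [AddCommGroup A] : FinGrpd.{w}ᵒᵖ ⥤ AddCommGrpCat.{w + 1} where
  obj C := AddCommGrpCat.of (H1 C.unop.obj A)
  map F := AddCommGrpCat.ofHom (H1.map A F.unop.hom)
  map_id _ := by
    ext x
    rfl
  map_comp _ _ := by
    ext x
    rfl

/-- `H⁰(-, ℤ/p)` on pro-objects in finite groupoids. -/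
noncomputable def proH0 (p : ℕ) : (Pro FinGrpd.{w})ᵒᵖ ⥤ AddCommGrpCat.{w + 1} :=
  Pro.extend (H0Fin.{w} (ULift.{w + 1} (ZMod p)))

/-- `H¹(-, ℤ/p)` on pro-objects in finite groupoids. -/
noncomputable def proH1 (p : ℕ) : (Pro FinGrpd.{w})ᵒᵖ ⥤ AddCommGrpCat.{w + 1} :=
  Pro.extend (H1Fin.{w} (ULift.{w + 1} (ZMod p)))

end Cohomology

end ProGrpd

/-!
The model structure exists because the lifting properties in the statement are statements about
cochains. For a finite groupoid `K` there is an exact sequence `0 → H⁰ → C⁰ → Z¹ → H¹ → 0`, where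
`C⁰` and `Z¹` are the groups of functions on objects and of cocycles with values in `ℤ/p`. The
functors `C⁰`, `Z¹`, `H⁰` are represented by `ℤ/p // ℤ/p`, by `* // ℤ/p` and by the set `ℤ/p`, and
the coboundary `C⁰ → Z¹` by `ℤ/p // ℤ/p → * // ℤ/p`. Filtered colimits are exact, so all of this
extends to pro-objects (`Pro.extendMap_exact`, `Pro.IsUniversal.cls_bijective`). Hence a map is a
cofibration if and only if it is surjective on `C⁰`, and a diagram chase
(`cofib_and_isCohomologyIso_iff`) shows that the cofibrations that are isomorphisms on `H⁰` and `H¹`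
are the maps with the left lifting property against the three maps of the statement.

It remains to factor maps. The factorization of `f : X ⟶ Y` in a trivial cofibration and a
fibration is the small object argument, performed in the category of ind-objects of the opposite
category, where the objects of the original category are finitely presentable
(`hasFactorization_llp_const`). The factorization in a cofibration and a trivial fibration is
obtained in one step (`exists_factorization`), through the product of `Y` and of one copy of
`ℤ/p // ℤ/p` for each map from `X` to `ℤ/p // ℤ/p`. The projection of this product to `Y` is a
homotopy equivalence, the homotopy being defined on a cylinder (`exists_cylinder`) that is the limit
of the cylinders of finite groupoids. The retract argument (`rlp_cofib`) then identifies the trivial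
fibrations with the maps that have the right lifting property against the cofibrations.

Limits of pro-objects come from the finite limits of finite groupoids. For colimits, finite
groupoids form an essentially small category, so that the ind-objects of the opposite category are
exactly the left exact presheaves, and a limit of left exact presheaves is left exact.
-/

namespace ProGrpd

open Limits Opposite

/-! ### Finite limits of finite groupoids -/

section FiniteLimits

instance : HasLimits Grpd.{w, w} where
  has_limits_of_shape J _ := hasLimitsOfShape_of_reflective (J := J) Grpd.forgetToCat

instance (C : FinGrpd.{w}) : Finite (Arrow C.obj) := C.property

lemma finite_of_finite_arrow (C : Type u) [Category.{v} C] [Finite (Arrow C)] : Finite C :=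
  Finite.of_injective (fun x : C => Arrow.mk (𝟙 x)) fun _ _ h => congrArg Comma.left h

lemma finite_hom_of_finite_arrow {C : Type u} [Category.{v} C] [Finite (Arrow C)] (x y : C) :
    Finite (x ⟶ y) :=
  Finite.of_injective (fun f : x ⟶ y => Arrow.mk f) fun f g h => by
    simpa [Arrow.mk_eq_mk_iff] using h

instance (C : FinGrpd.{w}) : Finite C.obj := finite_of_finite_arrow _

instance (C : FinGrpd.{w}) (x y : C.obj) : Finite (x ⟶ y) := finite_hom_of_finite_arrow x y

/-- The walking arrow `0 ⟶ 1`, as an object of `Cat.{w, w}`. -/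
abbrev walkingArrow : Cat.{w, w} := Cat.of (AsSmall.{w} (Fin 2))

/-- The arrow classified by a functor from the walking arrow. -/
def arrowOfFunctor {C : Type u} [Category.{v} C] (F : walkingArrow.{w} ⥤ C) : Arrow C :=
  ((Functor.mapArrow (AsSmall.up ⋙ F)).obj
    (Arrow.mk (homOfLE (Fin.zero_le (1 : Fin 2)))))

lemma arrowOfFunctor_bijective (C : Type u) [Category.{v} C] :
    Function.Bijective (arrowOfFunctor (C := C)) := by
  constructor
  · intro F G h
    have h' : AsSmall.up ⋙ F = AsSmall.up ⋙ G :=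
      ComposableArrows.arrowEquiv.injective h
    exact congrArg (fun H => AsSmall.down ⋙ H) h'
  · intro f
    exact ⟨AsSmall.down ⋙ ComposableArrows.mk₁ f.hom, rfl⟩

/-- The arrows of a category are represented by the walking arrow, so the arrows of a limit of
groupoids inject in the product of the sets of arrows. -/
lemma arrow_injective_of_isLimit {J : Type} [SmallCategory J] [FinCategory J]
    {F : J ⥤ Grpd.{w, w}} {c : Cone F} (hc : IsLimit c) :
    Function.Injective fun (f : Arrow c.pt) (j : J) =>
      (c.π.app j : c.pt ⥤ F.obj j).mapArrow.obj f := by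
  intro f g h
  obtain ⟨F', rfl⟩ := (arrowOfFunctor_bijective.{w} c.pt).2 f
  obtain ⟨G', rfl⟩ := (arrowOfFunctor_bijective.{w} c.pt).2 g
  congr 1
  have h2 := isLimitOfPreserves Grpd.forgetToCat hc
  have : F'.toCatHom = G'.toCatHom := h2.hom_ext fun j => by
    apply Cat.Hom.ext
    exact (arrowOfFunctor_bijective.{w} (F.obj j)).1 (congrFun h j)
  exact congrArg Cat.Hom.toFunctor this

instance (J : Type) [SmallCategory J] [FinCategory J] :
    IsFiniteGrpd.{w}.IsClosedUnderLimitsOfShape J where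
  limitsOfShape_le := by
    rintro X ⟨h⟩
    have (j : J) : Finite (Arrow (h.diag.obj j)) := h.prop_diag_obj j
    exact Finite.of_injective _ (arrow_injective_of_isLimit h.isLimit)

instance : HasFiniteLimits FinGrpd.{w} :=
  ⟨fun J _ _ => by
    have : HasLimitsOfShape J Grpd.{w, w} :=
      HasFiniteLimits.out (C := Grpd.{w, w}) J
    infer_instance⟩

end FiniteLimits

/-! ### Finite groupoids form an essentially small category -/

section EssentiallySmall

/-- A fully faithful functor that is bijective on objects is an isomorphism of categories. -/
lemma exists_strict_inverse {C : Type u} [Category.{v} C] {D : Type u'} [Category.{w} D]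
    (F : C ⥤ D) [F.Full] [F.Faithful] (h : Function.Bijective F.obj) :
    ∃ G : D ⥤ C, F ⋙ G = 𝟭 C ∧ G ⋙ F = 𝟭 D := by
  choose g hg using h.2
  let G : D ⥤ C :=
    { obj := g
      map {x y} f := F.preimage (eqToHom (hg x) ≫ f ≫ eqToHom (hg y).symm)
      map_id x := F.map_injective (by simp)
      map_comp f f' := F.map_injective (by simp) }
  have hG (x : C) : g (F.obj x) = x := h.1 (hg _)
  refine ⟨G, CategoryTheory.Functor.ext hG fun x y f => F.map_injective ?_,
    CategoryTheory.Functor.ext hg fun x y f => ?_⟩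
  · simp [G, eqToHom_map]
  · simp [G]

/-- Every finite groupoid is isomorphic to a category whose objects and morphisms are natural
numbers. -/
lemma exists_smallCategoryOfSet (C : FinGrpd.{w}) :
    ∃ (S : SmallCategoryOfSet (ULift.{w} ℕ)) (F : S.obj ⥤ C.obj) (G : C.obj ⥤ S.obj),
      F ⋙ G = 𝟭 _ ∧ G ⋙ F = 𝟭 _ := by
  obtain ⟨f₁, h₁⟩ := Countable.exists_injective_nat C.obj
  have (x y : C.obj) := Countable.exists_injective_nat (x ⟶ y)
  choose f₂ h₂ using this
  let e := Equiv.ofInjective _ (ULift.up_injective.comp h₁)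
  let h : CoreSmallCategoryOfSet (ULift.{w} ℕ) C.obj :=
    { obj := Set.range (ULift.up ∘ f₁)
      hom X Y := Set.range (ULift.up ∘ f₂ (e.symm X) (e.symm Y))
      objEquiv := e.symm
      homEquiv := (Equiv.ofInjective _ (ULift.up_injective.comp (h₂ _ _))).symm }
  obtain ⟨G, hG⟩ := exists_strict_inverse h.functor h.objEquiv.bijective
  exact ⟨_, _, G, hG⟩

instance : EssentiallySmall.{w} FinGrpd.{w} := by
  rw [essentiallySmall_iff]
  refine ⟨?_, inferInstance⟩
  choose S F G h using exists_smallCategoryOfSet.{w}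
  refine small_of_injective (f := fun X : Skeleton FinGrpd.{w} => S X.out) fun X Y hXY => ?_
  suffices ∀ C D : FinGrpd.{w}, S C = S D → Nonempty (C ≅ D) from
    Quotient.out_equiv_out.1 (this _ _ hXY)
  intro C D hCD
  have key : ∀ (T : SmallCategoryOfSet (ULift.{w} ℕ)) (F' : T.obj ⥤ D.obj) (G' : D.obj ⥤ T.obj),
      F' ⋙ G' = 𝟭 _ ∧ G' ⋙ F' = 𝟭 _ → S C = T → Nonempty (C ≅ D) := by
    rintro _ F' G' ⟨h₁, h₂⟩ rfl
    refine ⟨⟨FinGrpd.ofFunctor (G C ⋙ F'), FinGrpd.ofFunctor (G' ⋙ F C), ?_, ?_⟩⟩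
    · apply ObjectProperty.hom_ext
      change G C ⋙ (F' ⋙ G') ⋙ F C = 𝟭 _
      rw [h₁]
      exact (h C).2
    · apply ObjectProperty.hom_ext
      change G' ⋙ (F C ⋙ G C) ⋙ F' = 𝟭 _
      rw [(h C).1]
      exact h₂
  exact key _ _ _ (h D) hCD

end EssentiallySmall

/-! ### Limits of ind-objects -/

section IndLimits

variable {C : Type u} [Category.{v} C]

/-- An ind-object is a filtered colimit of representable presheaves, hence left exact. -/
lemma preservesFiniteLimits_of_isIndObject {A : Cᵒᵖ ⥤ Type v} (hA : IsIndObject A) :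
    PreservesFiniteLimits A := by
  let P := hA.presentation
  let e : (P.F ⋙ yoneda).flip ⋙ colim ≅ A :=
    (colimitIsoFlipCompColim (P.F ⋙ yoneda)).symm ≪≫
      (colimit.isColimit _).coconePointUniqueUpToIso P.isColimit
  have : PreservesFiniteLimits (P.F ⋙ yoneda).flip :=
    ⟨fun J _ _ => preservesLimitsOfShape_of_evaluation _ _ fun i =>
      inferInstanceAs (PreservesLimitsOfShape J (yoneda.obj (P.F.obj i)))⟩
  have : PreservesFiniteLimits ((P.F ⋙ yoneda).flip ⋙ colim) := comp_preservesFiniteLimits _ _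
  exact preservesFiniteLimits_of_natIso e

variable [EssentiallySmall.{v} C]

/-- Presheaves are not a locally small category, but by the Yoneda lemma the morphisms from a
representable presheaf to `A` are few. -/
lemma essentiallySmall_costructuredArrow_yoneda (A : Cᵒᵖ ⥤ Type v) :
    EssentiallySmall.{v} (CostructuredArrow yoneda A) := by
  rw [← essentiallySmall_congr
    (CostructuredArrow.pre (equivSmallModel.{v} C).inverse yoneda A).asEquivalence,
    essentiallySmall_iff]
  refine ⟨?_, locallySmall_of_faithful (CostructuredArrow.proj _ _)⟩
  have : Small.{v} (CostructuredArrow ((equivSmallModel.{v} C).inverse ⋙ yoneda) A) :=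
    small_of_surjective (f := fun (f : Σ X : SmallModel.{v} C,
        A.obj (op ((equivSmallModel.{v} C).inverse.obj X))) =>
      CostructuredArrow.mk (S := (equivSmallModel.{v} C).inverse ⋙ yoneda)
        (yonedaEquiv.symm f.2)) fun f => by
      obtain ⟨X, f, rfl⟩ := f.mk_surjective
      exact ⟨⟨X, yonedaEquiv f⟩, congrArg _ (yonedaEquiv.symm_apply_apply f)⟩
  exact small_of_surjective Quotient.exists_rep

variable [HasFiniteColimits C]

/-- The ind-objects are the left exact presheaves, and these are closed under limits. -/
instance (J : Type v) [SmallCategory J] :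
    ObjectProperty.IsClosedUnderLimitsOfShape (IsIndObject (C := C)) J where
  limitsOfShape_le := by
    rintro A ⟨h⟩
    have (j : J) : PreservesFiniteLimits (h.diag.obj j) :=
      preservesFiniteLimits_of_isIndObject (h.prop_diag_obj j)
    have : PreservesFiniteLimits A := ⟨fun K _ _ => by
      have h1 : PreservesLimitsOfShape K h.diag.flip :=
        preservesLimitsOfShape_of_evaluation _ _ fun j =>
          inferInstanceAs (PreservesLimitsOfShape K (h.diag.obj j))
      have h2 : PreservesLimitsOfShape K (lim : (J ⥤ Type v) ⥤ _) := inferInstance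
      exact preservesLimitsOfShape_of_natIso ((limitIsoFlipCompLim h.diag).symm ≪≫
        (limit.isLimit _).conePointUniqueUpToIso h.isLimit)⟩
    exact (isIndObject_iff A).2
      ⟨isFiltered_costructuredArrow_yoneda_of_preservesFiniteLimits A,
        have := essentiallySmall_costructuredArrow_yoneda A
        finallySmall_of_essentiallySmall _⟩

instance : HasLimits (Ind C) where
  has_limits_of_shape _ _ :=
    Adjunction.hasLimitsOfShape_of_equivalence (Ind.equivalence C).functor

end IndLimits

instance : HasLimits (Pro FinGrpd.{w}) := inferInstance

instance : HasColimits (Pro FinGrpd.{w}) := inferInstance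

/-! ### Elements of the extension of a functor to pro-objects -/

section Extend

variable {C : Type (w + 1)} [Category.{w} C]

namespace Pro

/-- The class in the value at a pro-object `X` of the extension of `F`, of an element of `F K`,
for a morphism from `X` to the constant pro-object `K`. -/
noncomputable def cls (F : Cᵒᵖ ⥤ AddCommGrpCat.{w + 1}) {X : Pro C} {K : C}
    (φ : X ⟶ const.obj K) : F.obj (op K) ⟶ (extend F).obj (op X) :=
  colimit.ι (CostructuredArrow.proj (Ind.yoneda (C := Cᵒᵖ)) X.unop ⋙ F)
    (CostructuredArrow.mk (Y := op K) φ.unop)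

variable (F : Cᵒᵖ ⥤ AddCommGrpCat.{w + 1}) {X Y : Pro C} {K L : C}

lemma cls_comp (φ : X ⟶ const.obj K) (u : K ⟶ L) (a : F.obj (op L)) :
    cls F (φ ≫ const.map u) a = cls F φ (F.map u.op a) := by
  have := colimit.w (CostructuredArrow.proj (Ind.yoneda (C := Cᵒᵖ)) X.unop ⋙ F)
    (CostructuredArrow.homMk u.op rfl : CostructuredArrow.mk (Y := op L) (φ ≫ const.map u).unop ⟶
      CostructuredArrow.mk (Y := op K) φ.unop)
  exact (ConcreteCategory.congr_hom this a).symm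

lemma map_cls (f : X ⟶ Y) (φ : Y ⟶ const.obj K) (a : F.obj (op K)) :
    (extend F).map f.op (cls F φ a) = cls F (f ≫ φ) a := by
  have h : cls F φ ≫ (extend F).map f.op = cls F (f ≫ φ) :=
    colimit.ι_desc (F := CostructuredArrow.proj (Ind.yoneda (C := Cᵒᵖ)) Y.unop ⋙ F) _
      (CostructuredArrow.mk (Y := op K) φ.unop)
  exact ConcreteCategory.congr_hom h a

instance : PreservesFilteredColimitsOfSize.{w, w + 1} (forget AddCommGrpCat.{w + 1}) :=
  preservesFilteredColimitsOfSize_of_univLE.{w + 1, w + 1} _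

lemma exists_cls (x : (extend F).obj (op X)) :
    ∃ (K : C) (φ : X ⟶ const.obj K) (a : F.obj (op K)), cls F φ a = x := by
  obtain ⟨j, a, h⟩ := Concrete.colimit_exists_rep
    (CostructuredArrow.proj (Ind.yoneda (C := Cᵒᵖ)) X.unop ⋙ F) x
  exact ⟨j.left.unop, j.hom.op, a, h⟩

lemma exists_eq_of_cls_eq {φ : X ⟶ const.obj K} {φ' : X ⟶ const.obj L} {a : F.obj (op K)}
    {b : F.obj (op L)} (h : cls F φ a = cls F φ' b) :
    ∃ (M : C) (ψ : X ⟶ const.obj M) (u : M ⟶ K) (v : M ⟶ L),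
      ψ ≫ const.map u = φ ∧ ψ ≫ const.map v = φ' ∧ F.map u.op a = F.map v.op b := by
  obtain ⟨j, f, g, e⟩ := Concrete.colimit_exists_of_rep_eq _ _ _ h
  exact ⟨j.left.unop, j.hom.op, f.left.unop, g.left.unop,
    Quiver.Hom.unop_inj (CostructuredArrow.w f), Quiver.Hom.unop_inj (CostructuredArrow.w g), e⟩

lemma exists_map_eq_zero {φ : X ⟶ const.obj K} {a : F.obj (op K)} (h : cls F φ a = 0) :
    ∃ (M : C) (ψ : X ⟶ const.obj M) (u : M ⟶ K),
      ψ ≫ const.map u = φ ∧ F.map u.op a = 0 := by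
  obtain ⟨M, ψ, u, v, h₁, -, h₃⟩ := exists_eq_of_cls_eq F (φ := φ) (φ' := φ) (a := a) (b := 0)
    (by rw [h, map_zero])
  exact ⟨M, ψ, u, h₁, by rw [h₃, map_zero]⟩

variable {F} {G H : Cᵒᵖ ⥤ AddCommGrpCat.{w + 1}}

/-- The extension to pro-objects of a natural transformation. -/
noncomputable def extendMap (α : F ⟶ G) (X : Pro C) :
    (extend F).obj (op X) ⟶ (extend G).obj (op X) :=
  colimMap (Functor.whiskerLeft (CostructuredArrow.proj (Ind.yoneda (C := Cᵒᵖ)) X.unop) α)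

lemma extendMap_cls (α : F ⟶ G) (φ : X ⟶ const.obj K) (a : F.obj (op K)) :
    extendMap α X (cls F φ a) = cls G φ (α.app _ a) :=
  ConcreteCategory.congr_hom (ι_colimMap
    (Functor.whiskerLeft (CostructuredArrow.proj (Ind.yoneda (C := Cᵒᵖ)) X.unop) α)
    (CostructuredArrow.mk (Y := op K) φ.unop)) a

lemma extendMap_naturality (α : F ⟶ G) (f : X ⟶ Y) (x : (extend F).obj (op Y)) :
    extendMap α X ((extend F).map f.op x) = (extend G).map f.op (extendMap α Y x) := by
  obtain ⟨K, φ, a, rfl⟩ := exists_cls F x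
  rw [map_cls, extendMap_cls, extendMap_cls, map_cls]

/-- Filtered colimits preserve injectivity. -/
lemma extendMap_injective (α : F ⟶ G) (h : ∀ K, Function.Injective (α.app (op K))) (X : Pro C) :
    Function.Injective (extendMap α X) := by
  rw [injective_iff_map_eq_zero]
  intro x hx
  obtain ⟨K, φ, a, rfl⟩ := exists_cls F x
  rw [extendMap_cls] at hx
  obtain ⟨M, ψ, u, rfl, e⟩ := exists_map_eq_zero G hx
  have h0 : F.map u.op a = 0 := h M <| by
    rw [map_zero]
    exact (ConcreteCategory.congr_hom (α.naturality u.op) a).trans e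
  rw [cls_comp, h0, map_zero]

lemma extendMap_surjective (α : F ⟶ G) (h : ∀ K, Function.Surjective (α.app (op K))) (X : Pro C) :
    Function.Surjective (extendMap α X) := by
  intro x
  obtain ⟨K, φ, a, rfl⟩ := exists_cls G x
  obtain ⟨b, rfl⟩ := h K a
  exact ⟨cls F φ b, extendMap_cls _ _ _⟩

/-- Filtered colimits preserve exactness. -/
lemma extendMap_exact (α : F ⟶ G) (β : G ⟶ H)
    (h : ∀ K, Function.Exact (α.app (op K)) (β.app (op K))) (X : Pro C) :
    Function.Exact (extendMap α X) (extendMap β X) := by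
  intro x
  constructor
  · intro hx
    obtain ⟨K, φ, a, rfl⟩ := exists_cls G x
    rw [extendMap_cls] at hx
    obtain ⟨M, ψ, u, rfl, e⟩ := exists_map_eq_zero H hx
    obtain ⟨b, hb⟩ := (h M (G.map u.op a)).1
      ((ConcreteCategory.congr_hom (β.naturality u.op) a).trans e)
    exact ⟨cls F ψ b, by rw [extendMap_cls, hb, cls_comp]⟩
  · rintro ⟨y, rfl⟩
    obtain ⟨K, φ, a, rfl⟩ := exists_cls F y
    rw [extendMap_cls, extendMap_cls, (h K _).2 ⟨a, rfl⟩, map_zero]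

/-- `r` is a universal element of `F`. -/
def IsUniversal (F : Cᵒᵖ ⥤ AddCommGrpCat.{w + 1}) {R : C} (r : F.obj (op R)) : Prop :=
  ∀ K : C, Function.Bijective fun u : K ⟶ R => F.map u.op r

/-- If `F` is represented by `R`, its extension is represented by the constant pro-object `R`. -/
lemma IsUniversal.cls_bijective {R : C} {r : F.obj (op R)} (hr : IsUniversal F r) (X : Pro C) :
    Function.Bijective fun φ : X ⟶ const.obj R => cls F φ r := by
  constructor
  · intro φ φ' h
    obtain ⟨M, ψ, u, v, rfl, rfl, e⟩ := exists_eq_of_cls_eq F h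
    rw [(hr M).1 e]
  · intro x
    obtain ⟨K, φ, a, rfl⟩ := exists_cls F x
    obtain ⟨u, rfl⟩ := (hr K).2 a
    exact ⟨φ ≫ const.map u, cls_comp _ _ _ _⟩

end Pro

end Extend

/-! ### Cochains and cocycles of finite groupoids -/

section Cochains

variable (A : Type (w + 1)) [AddCommGroup A]

/-- The group of functions on the objects of a finite groupoid, as a contravariant functor. -/
def C0Fin : FinGrpd.{w}ᵒᵖ ⥤ AddCommGrpCat.{w + 1} where
  obj C := AddCommGrpCat.of (C.unop.obj → A)
  map F := AddCommGrpCat.ofHom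
    { toFun := fun a x => a (F.unop.hom.obj x)
      map_zero' := rfl
      map_add' := fun _ _ => rfl }
  map_id _ := rfl
  map_comp _ _ := rfl

/-- The group of `1`-cocycles of a finite groupoid, as a contravariant functor. -/
def Z1Fin : FinGrpd.{w}ᵒᵖ ⥤ AddCommGrpCat.{w + 1} where
  obj C := AddCommGrpCat.of (Z1 C.unop.obj A)
  map F := AddCommGrpCat.ofHom (Z1.map A F.unop.hom)
  map_id _ := rfl
  map_comp _ _ := rfl

/-- The inclusion of the locally constant functions in the functions. -/
def inclH0 : H0Fin.{w} A ⟶ C0Fin A where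
  app C := AddCommGrpCat.ofHom (H0 C.unop.obj A).subtype
  naturality _ _ _ := rfl

/-- The coboundary from functions to cocycles. -/
def coboundary : C0Fin.{w} A ⟶ Z1Fin A where
  app C := AddCommGrpCat.ofHom (d0 C.unop.obj A)
  naturality _ _ _ := rfl

/-- The projection from cocycles to cohomology classes. -/
def projH1 : Z1Fin.{w} A ⟶ H1Fin A where
  app C := AddCommGrpCat.ofHom (QuotientAddGroup.mk' (d0 C.unop.obj A).range)
  naturality _ _ _ := rfl

lemma inclH0_injective (C : FinGrpd.{w}) : Function.Injective ((inclH0 A).app (op C)) :=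
  Subtype.val_injective

lemma exact_inclH0_coboundary (C : FinGrpd.{w}) :
    Function.Exact ((inclH0 A).app (op C)) ((coboundary A).app (op C)) := by
  intro a
  constructor
  · intro h
    refine ⟨⟨a, fun x y f => ?_⟩, rfl⟩
    exact (sub_eq_zero.1 (congrFun (congrFun (congrFun (congrArg Subtype.val h) x) y) f)).symm
  · rintro ⟨⟨b, hb⟩, rfl⟩
    refine Subtype.ext (funext fun x => funext fun y => funext fun f => ?_)
    exact sub_eq_zero.2 (hb f).symm

lemma exact_coboundary_projH1 (C : FinGrpd.{w}) :
    Function.Exact ((coboundary A).app (op C)) ((projH1 A).app (op C)) := fun z =>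
  QuotientAddGroup.eq_zero_iff (N := (d0 C.obj A).range) z

lemma projH1_surjective (C : FinGrpd.{w}) : Function.Surjective ((projH1 A).app (op C)) :=
  QuotientAddGroup.mk'_surjective (d0 C.obj A).range

end Cochains

/-! ### Representability of cochains, cocycles and locally constant functions -/

section Universal

variable (p : ℕ) [NeZero p]

/-- The coefficient group `ℤ/p`, in the universe of the cohomology groups. -/
abbrev Coeff (p : ℕ) : Type (w + 1) := ULift.{w + 1} (ZMod p)

/-- The additive residue underlying an element of the multiplicative cyclic group. -/
def Cyc.toCoeff {p : ℕ} (g : Cyc.{w} p) : Coeff.{w} p := ⟨g.down.toAdd⟩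

/-- The element of the multiplicative cyclic group attached to an additive residue. -/
def Coeff.toCyc {p : ℕ} (a : Coeff.{w} p) : Cyc.{w} p := ⟨Multiplicative.ofAdd a.down⟩

lemma Cyc.toCoeff_injective {p : ℕ} : Function.Injective (Cyc.toCoeff.{w} (p := p)) :=
  fun g h e => by
    have : g.down.toAdd = h.down.toAdd := congrArg ULift.down e
    exact ULift.ext _ _ (Multiplicative.toAdd.injective this)

/-- The tautological function on the objects of `ℤ/p // ℤ/p`. -/
def universalC0 : (C0Fin.{w} (Coeff p)).obj (op (cycModCyc p)) :=
  fun s : ActionGrpd (Cyc.{w} p) (Cyc.{w} p) => s.pt.toCoeff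

/-- The tautological cocycle on `* // ℤ/p`. -/
def universalZ1 : (Z1Fin.{w} (Coeff p)).obj (op (pointModCyc p)) :=
  ⟨fun (_ _ : ActionGrpd PUnit.{w + 1} (Cyc.{w} p)) g => g.1.toCoeff, fun _ _ _ _ _ => rfl⟩

/-- The tautological locally constant function on the set `ℤ/p`. -/
def universalH0 : (H0Fin.{w} (Coeff p)).obj (op (discreteCyc p)) :=
  ⟨fun s : Discrete (Cyc.{w} p) => s.as.toCoeff, by
    exact fun (x y : Discrete (Cyc.{w} p)) f => congrArg Cyc.toCoeff (Discrete.eq_of_hom f)⟩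

instance (s s' : ActionGrpd (Cyc.{w} p) (Cyc.{w} p)) : Subsingleton (s ⟶ s') :=
  ⟨fun g h => Subtype.ext (mul_left_cancel (g.2.trans h.2.symm))⟩

lemma ActionGrpd.pt_injective (S : Type u) (G : Type u') :
    Function.Injective (ActionGrpd.pt : ActionGrpd S G → S) := by
  rintro ⟨s⟩ ⟨t⟩ h
  exact congrArg _ h

lemma isUniversal_universalC0 : Pro.IsUniversal (C0Fin.{w} (Coeff p)) (universalC0 p) := by
  intro K
  constructor
  · intro u v h
    refine ObjectProperty.hom_ext _ ?_
    refine CategoryTheory.Functor.ext (C := K.obj) (D := ActionGrpd (Cyc.{w} p) (Cyc.{w} p))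
      (fun x => ?_) (fun x y f => Subsingleton.elim _ _)
    exact ActionGrpd.pt_injective _ _ (Cyc.toCoeff_injective (congrFun h x))
  · intro a
    let F : K.obj ⥤ ActionGrpd (Cyc.{w} p) (Cyc.{w} p) :=
      { obj := fun x => ⟨(a x : Coeff p).toCyc⟩
        map := fun {x y} _ => ⟨(a x : Coeff p).toCyc⁻¹ * (a y : Coeff p).toCyc,
          mul_inv_cancel_left _ _⟩
        map_id := fun _ => Subsingleton.elim _ _
        map_comp := fun _ _ => Subsingleton.elim _ _ }
    exact ⟨FinGrpd.ofFunctor (D := cycModCyc p) F, rfl⟩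

lemma isUniversal_universalZ1 : Pro.IsUniversal (Z1Fin.{w} (Coeff p)) (universalZ1 p) := by
  intro K
  constructor
  · intro u v h
    refine ObjectProperty.hom_ext _ ?_
    have (x : K.obj) : u.hom.obj x = v.hom.obj x :=
      ActionGrpd.pt_injective PUnit.{w + 1} (Cyc.{w} p) rfl
    refine CategoryTheory.Functor.hext (C := K.obj) (D := ActionGrpd PUnit.{w + 1} (Cyc.{w} p))
      this (fun x y f => heq_of_eq ?_)
    refine Subtype.ext (Cyc.toCoeff_injective ?_)
    exact congrFun (congrFun (congrFun (congrArg Subtype.val h) x) y) f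
  · intro z
    let F : K.obj ⥤ ActionGrpd PUnit.{w + 1} (Cyc.{w} p) :=
      { obj := fun _ => ⟨PUnit.unit⟩
        map := fun {x y} f => ⟨(z.1 x y f : Coeff p).toCyc, rfl⟩
        map_id := fun x => Subtype.ext <| Cyc.toCoeff_injective <| by
          have := z.2 (𝟙 x) (𝟙 x)
          rw [Category.comp_id] at this
          exact left_eq_add.1 this
        map_comp := fun f g => Subtype.ext <| Cyc.toCoeff_injective <| z.2 f g }
    exact ⟨FinGrpd.ofFunctor (D := pointModCyc p) F, rfl⟩

lemma isUniversal_universalH0 : Pro.IsUniversal (H0Fin.{w} (Coeff p)) (universalH0 p) := by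
  intro K
  constructor
  · intro u v h
    refine ObjectProperty.hom_ext _ ?_
    refine CategoryTheory.Functor.ext (C := K.obj) (D := Discrete (Cyc.{w} p))
      (fun x => Discrete.ext ?_) (fun x y f => Subsingleton.elim _ _)
    exact Cyc.toCoeff_injective (congrFun (congrArg Subtype.val h) x)
  · intro a
    let F : K.obj ⥤ Discrete (Cyc.{w} p) :=
      { obj := fun x => ⟨(a.1 x : Coeff p).toCyc⟩
        map := fun f => Discrete.eqToHom (congrArg Coeff.toCyc (a.2 f))
        map_id := fun _ => Subsingleton.elim _ _
        map_comp := fun _ _ => Subsingleton.elim _ _ }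
    exact ⟨FinGrpd.ofFunctor (D := discreteCyc p) F, rfl⟩

/-- The map `ℤ/p // ℤ/p → * // ℤ/p` represents the coboundary. -/
lemma map_universalZ1 : (Z1Fin.{w} (Coeff p)).map (cycModCycToPointModCyc p).op (universalZ1 p) =
    (coboundary (Coeff p)).app _ (universalC0 p) := by
  refine Subtype.ext (funext fun x => funext fun y => funext fun g => ?_)
  refine (sub_eq_of_eq_add' (?_ : Cyc.toCoeff (ActionGrpd.pt y) = _)).symm
  exact congrArg Cyc.toCoeff g.2.symm

/-- The map `0 : * → ℤ/p` represents the zero function. -/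
lemma map_universalH0 :
    (H0Fin.{w} (Coeff p)).map (pointToDiscreteCyc p).op (universalH0 p) = 0 := rfl

lemma toPoint_unique {K : FinGrpd.{w}} (u v : K ⟶ point.{w}) : u = v :=
  ObjectProperty.hom_ext _ (CategoryTheory.Functor.ext (D := Discrete PUnit.{w + 1})
    (fun _ => Subsingleton.elim _ _) (fun _ _ _ => Subsingleton.elim _ _))

/-- The constant pro-object on the point is terminal. -/
lemma Pro.nonempty_unique_hom_point (X : Pro FinGrpd.{w}) :
    Nonempty (Unique (X ⟶ Pro.const.obj point.{w})) := by
  -- The point represents the zero functor.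
  let F : FinGrpd.{w}ᵒᵖ ⥤ AddCommGrpCat.{w + 1} :=
    (Functor.const _).obj (AddCommGrpCat.of PUnit)
  have hF : Pro.IsUniversal F (R := point) PUnit.unit :=
    fun K => ⟨fun u v _ => toPoint_unique u v, fun _ => ⟨toPoint K, rfl⟩⟩
  obtain ⟨φ, -⟩ := (hF.cls_bijective X).2 0
  exact ⟨⟨⟨φ⟩, fun ψ => (hF.cls_bijective X).1
    ((map_zero (Pro.cls F ψ).hom).trans (map_zero (Pro.cls F φ).hom).symm)⟩⟩

end Universal

/-! ### Lifting properties in terms of cochains -/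

section Lifting

/-- A lifting property against the map from a finite groupoid `R` to the point is the surjectivity
of the map induced on the functor that `R` represents. -/
lemma hasLiftingProperty_toPoint_iff {F : FinGrpd.{w}ᵒᵖ ⥤ AddCommGrpCat.{w + 1}} {R : FinGrpd.{w}}
    {r : F.obj (op R)} (hr : Pro.IsUniversal F r) {X Y : Pro FinGrpd.{w}} (f : X ⟶ Y) :
    HasLiftingProperty f (Pro.const.map (toPoint R)) ↔
      Function.Surjective ((Pro.extend F).map f.op) := by
  obtain ⟨uX⟩ := Pro.nonempty_unique_hom_point X
  obtain ⟨uY⟩ := Pro.nonempty_unique_hom_point Y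
  constructor
  · intro h x
    obtain ⟨φ, rfl⟩ := (hr.cls_bijective X).2 x
    have sq : CommSq φ f (Pro.const.map (toPoint R)) default := ⟨Subsingleton.elim _ _⟩
    exact ⟨Pro.cls F sq.lift r, by rw [Pro.map_cls, sq.fac_left]⟩
  · intro h
    refine ⟨fun {φ g} sq => ?_⟩
    obtain ⟨y, hy⟩ := h (Pro.cls F φ r)
    obtain ⟨ψ, rfl⟩ := (hr.cls_bijective Y).2 y
    exact ⟨⟨⟨ψ, (hr.cls_bijective X).1 ((Pro.map_cls F f ψ r).symm.trans hy),
      Subsingleton.elim _ _⟩⟩⟩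

variable (p : ℕ) [NeZero p] {X Y : Pro FinGrpd.{w}} (f : X ⟶ Y)

/-- Functions with values in `ℤ/p` on the objects of a pro-object. -/
noncomputable abbrev proC0 (p : ℕ) : (Pro FinGrpd.{w})ᵒᵖ ⥤ AddCommGrpCat.{w + 1} :=
  Pro.extend (C0Fin.{w} (Coeff p))

/-- Cocycles with values in `ℤ/p` on a pro-object. -/
noncomputable abbrev proZ1 (p : ℕ) : (Pro FinGrpd.{w})ᵒᵖ ⥤ AddCommGrpCat.{w + 1} :=
  Pro.extend (Z1Fin.{w} (Coeff p))

/-- The coboundary of functions on a pro-object. -/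
noncomputable abbrev proCoboundary (p : ℕ) (X : Pro FinGrpd.{w}) :
    (proC0.{w} p).obj (op X) ⟶ (proZ1.{w} p).obj (op X) :=
  Pro.extendMap (coboundary (Coeff p)) X

lemma hasLiftingProperty_cycModCyc_iff :
    HasLiftingProperty f (Pro.const.map (toPoint (cycModCyc.{w} p))) ↔
      Function.Surjective ((proC0.{w} p).map f.op) :=
  hasLiftingProperty_toPoint_iff (isUniversal_universalC0 p) f

lemma hasLiftingProperty_pointModCyc_iff :
    HasLiftingProperty f (Pro.const.map (toPoint (pointModCyc.{w} p))) ↔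
      Function.Surjective ((proZ1.{w} p).map f.op) :=
  hasLiftingProperty_toPoint_iff (isUniversal_universalZ1 p) f

lemma hasLiftingProperty_pointToDiscreteCyc_iff :
    HasLiftingProperty f (Pro.const.map (pointToDiscreteCyc.{w} p)) ↔
      Function.Injective ((proH0.{w} p).map f.op) := by
  obtain ⟨uX⟩ := Pro.nonempty_unique_hom_point X
  obtain ⟨uY⟩ := Pro.nonempty_unique_hom_point Y
  have hu := isUniversal_universalH0.{w} p
  have zero (Z : Pro FinGrpd.{w}) (φ : Z ⟶ Pro.const.obj point) :
      Pro.cls (H0Fin.{w} (Coeff p)) (φ ≫ Pro.const.map (pointToDiscreteCyc p)) (universalH0 p) =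
        0 := by
    rw [Pro.cls_comp, map_universalH0, map_zero]
  constructor
  · intro h
    refine (injective_iff_map_eq_zero ((proH0.{w} p).map f.op).hom).2 fun y hy => ?_
    obtain ⟨ψ, rfl⟩ := (hu.cls_bijective Y).2 y
    have sq : CommSq default f (Pro.const.map (pointToDiscreteCyc p)) ψ :=
      ⟨(hu.cls_bijective X).1 ((zero _ _).trans
        ((Pro.map_cls _ f ψ (universalH0 p)).symm.trans hy).symm)⟩
    have := zero _ sq.lift
    rwa [sq.fac_right] at this
  · intro h
    refine ⟨fun {φ ψ} sq => ?_⟩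
    have h0 : Pro.cls (H0Fin.{w} (Coeff p)) ψ (universalH0 p) = 0 := h <| by
      refine Eq.trans ?_ (map_zero ((proH0.{w} p).map f.op).hom).symm
      refine (Pro.map_cls (H0Fin.{w} (Coeff p)) f ψ (universalH0 p)).trans ?_
      rw [← sq.w]
      exact zero _ _
    exact ⟨⟨⟨default, Subsingleton.elim _ _,
      (hu.cls_bijective Y).1 ((zero _ _).trans h0.symm)⟩⟩⟩

lemma cls_comp_cycModCycToPointModCyc (φ : X ⟶ Pro.const.obj (cycModCyc.{w} p)) :
    Pro.cls (Z1Fin.{w} (Coeff p)) (φ ≫ Pro.const.map (cycModCycToPointModCyc p)) (universalZ1 p) =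
      proCoboundary p X (Pro.cls (C0Fin (Coeff p)) φ (universalC0 p)) := by
  rw [Pro.cls_comp, map_universalZ1, Pro.extendMap_cls]

lemma hasLiftingProperty_cycModCycToPointModCyc_iff :
    HasLiftingProperty f (Pro.const.map (cycModCycToPointModCyc.{w} p)) ↔
      ∀ (b : (proC0.{w} p).obj (op X)) (z : (proZ1.{w} p).obj (op Y)),
        proCoboundary p X b = (proZ1.{w} p).map f.op z →
          ∃ c, (proC0.{w} p).map f.op c = b ∧ proCoboundary p Y c = z := by
  have hE (Z : Pro FinGrpd.{w}) := (isUniversal_universalC0.{w} p).cls_bijective Z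
  have hB (Z : Pro FinGrpd.{w}) := (isUniversal_universalZ1.{w} p).cls_bijective Z
  constructor
  · intro h b z hbz
    obtain ⟨φ, rfl⟩ := (hE X).2 b
    obtain ⟨ψ, rfl⟩ := (hB Y).2 z
    have sq : CommSq φ f (Pro.const.map (cycModCycToPointModCyc p)) ψ := ⟨(hB X).1 <| by
      dsimp only
      rw [cls_comp_cycModCycToPointModCyc, ← Pro.map_cls]
      exact hbz⟩
    refine ⟨Pro.cls _ sq.lift (universalC0 p), ?_, ?_⟩
    · rw [Pro.map_cls, sq.fac_left]
    · rw [← cls_comp_cycModCycToPointModCyc, sq.fac_right]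
  · intro h
    refine ⟨fun {φ ψ} sq => ?_⟩
    obtain ⟨c, h₁, h₂⟩ := h (Pro.cls _ φ (universalC0 p)) (Pro.cls _ ψ (universalZ1 p)) (by
      rw [← cls_comp_cycModCycToPointModCyc, Pro.map_cls, sq.w])
    obtain ⟨l, rfl⟩ := (hE Y).2 c
    refine ⟨⟨⟨l, (hE X).1 ?_, (hB Y).1 ?_⟩⟩⟩
    · exact (Pro.map_cls _ _ _ _).symm.trans h₁
    · exact (cls_comp_cycModCycToPointModCyc p l).trans h₂

end Lifting

/-! ### Trivial cofibrations -/

section TrivialCofibrations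

variable (p : ℕ) [NeZero p] {X Y : Pro FinGrpd.{w}}

/-- A map that induces isomorphisms on `H⁰` and `H¹` with coefficients in `ℤ/p`. -/
def IsCohomologyIso (p : ℕ) : MorphismProperty (Pro FinGrpd.{w}) := fun _ _ f =>
  IsIso ((proH0.{w} p).map f.op) ∧ IsIso ((proH1.{w} p).map f.op)

/-- The maps with the left lifting property against `ℤ/p // ℤ/p → *`. -/
def cofib (p : ℕ) [NeZero p] : MorphismProperty (Pro FinGrpd.{w}) := fun _ _ f =>
  HasLiftingProperty f (Pro.const.map (toPoint (cycModCyc.{w} p)))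

/-- By a chase in the exact sequences `0 → H⁰ → C⁰ → Z¹ → H¹ → 0`, a map is surjective on `C⁰` and
an isomorphism on `H⁰` and `H¹` if and only if it is injective on `H⁰`, surjective on `Z¹`, and a
primitive on the source of the restriction of a cocycle always extends to a primitive on the
target. -/
lemma cofib_and_isCohomologyIso_iff (f : X ⟶ Y) :
    (cofib p f ∧ IsCohomologyIso p f) ↔
      HasLiftingProperty f (Pro.const.map (cycModCycToPointModCyc.{w} p)) ∧
      HasLiftingProperty f (Pro.const.map (toPoint (pointModCyc.{w} p))) ∧
      HasLiftingProperty f (Pro.const.map (pointToDiscreteCyc.{w} p)) := by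
  rw [cofib, IsCohomologyIso, hasLiftingProperty_cycModCyc_iff,
    hasLiftingProperty_cycModCycToPointModCyc_iff, hasLiftingProperty_pointModCyc_iff,
    hasLiftingProperty_pointToDiscreteCyc_iff, ConcreteCategory.isIso_iff_bijective,
    ConcreteCategory.isIso_iff_bijective]
  let i (Z : Pro FinGrpd.{w}) : (proH0.{w} p).obj (op Z) ⟶ (proC0.{w} p).obj (op Z) :=
    Pro.extendMap (inclH0 (Coeff p)) Z
  let q (Z : Pro FinGrpd.{w}) : (proZ1.{w} p).obj (op Z) ⟶ (proH1.{w} p).obj (op Z) :=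
    Pro.extendMap (projH1 (Coeff p)) Z
  have i_nat (a) : i X ((proH0.{w} p).map f.op a) = (proC0.{w} p).map f.op (i Y a) :=
    Pro.extendMap_naturality _ f a
  have d_nat (b) : proCoboundary p X ((proC0.{w} p).map f.op b) =
      (proZ1.{w} p).map f.op (proCoboundary p Y b) := Pro.extendMap_naturality _ f b
  have q_nat (z) : q X ((proZ1.{w} p).map f.op z) = (proH1.{w} p).map f.op (q Y z) :=
    Pro.extendMap_naturality _ f z
  have i_inj (Z) : Function.Injective (i Z) := Pro.extendMap_injective _ (inclH0_injective _) Z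
  have q_surj (Z) : Function.Surjective (q Z) := Pro.extendMap_surjective _ (projH1_surjective _) Z
  have exact_id (Z) : Function.Exact (i Z) (proCoboundary p Z) :=
    Pro.extendMap_exact _ _ (exact_inclH0_coboundary _) Z
  have exact_dq (Z) : Function.Exact (proCoboundary p Z) (q Z) :=
    Pro.extendMap_exact _ _ (exact_coboundary_projH1 _) Z
  constructor
  · rintro ⟨hC, hH0, hH1⟩
    refine ⟨fun b z hbz => ?_, fun z => ?_, hH0.1⟩
    · obtain ⟨b₁, rfl⟩ : ∃ b₁, proCoboundary p Y b₁ = z := (exact_dq Y z).1 <| hH1.1 <| by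
        rw [map_zero, ← q_nat, ← hbz]
        exact (exact_dq X _).2 ⟨b, rfl⟩
      -- `b` and the restriction of `b₁` differ by a class in `H⁰`, which extends.
      obtain ⟨a, ha⟩ := (exact_id X (b - (proC0.{w} p).map f.op b₁)).1 (by
        rw [map_sub, hbz, d_nat, sub_self])
      obtain ⟨a, rfl⟩ := hH0.2 a
      refine ⟨b₁ + i Y a, ?_, ?_⟩
      · rw [map_add, ← i_nat, ha, add_sub_cancel]
      · rw [map_add, (exact_id Y _).2 ⟨a, rfl⟩, add_zero]
    · obtain ⟨y, hy⟩ := hH1.2 (q X z)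
      obtain ⟨z₁, rfl⟩ := q_surj Y y
      obtain ⟨b, hb⟩ := (exact_dq X (z - (proZ1.{w} p).map f.op z₁)).1 (by
        rw [map_sub, q_nat, hy, sub_self])
      obtain ⟨b, rfl⟩ := hC b
      exact ⟨z₁ + proCoboundary p Y b, by rw [map_add, ← d_nat, hb, add_sub_cancel]⟩
  · rintro ⟨hL, hZ, hH0⟩
    refine ⟨fun b => ?_, ⟨hH0, fun a => ?_⟩, ?_, fun x => ?_⟩
    · obtain ⟨z, hz⟩ := hZ (proCoboundary p X b)
      obtain ⟨c, hc, -⟩ := hL b z hz.symm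
      exact ⟨c, hc⟩
    · obtain ⟨c, hc, hc'⟩ := hL (i X a) 0 (by rw [(exact_id X _).2 ⟨a, rfl⟩, map_zero])
      obtain ⟨a', rfl⟩ := (exact_id Y c).1 hc'
      exact ⟨a', i_inj X (by rw [i_nat, hc])⟩
    · refine (injective_iff_map_eq_zero ((proH1.{w} p).map f.op).hom).2 fun y hy => ?_
      obtain ⟨z, rfl⟩ := q_surj Y y
      obtain ⟨b, hb⟩ := (exact_dq X _).1 ((q_nat z).trans hy)
      obtain ⟨c, -, hc⟩ := hL b z hb
      exact (exact_dq Y z).2 ⟨c, hc⟩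
    · obtain ⟨z, rfl⟩ := q_surj X x
      obtain ⟨z, rfl⟩ := hZ z
      exact ⟨q Y z, (q_nat z).symm⟩

end TrivialCofibrations

/-! ### Factorizations cogenerated by maps between constant pro-objects -/

section Factorization

/-- The objects of `C` are finitely presentable as ind-objects: the morphisms from `K` to an
ind-object `X` are the elements of the presheaf `X` on `K`, and the inclusion of ind-objects in
presheaves preserves filtered colimits. -/
instance isFinitelyPresentable_indYoneda {C : Type u} [Category.{v} C] (K : C) :
    IsFinitelyPresentable.{v} ((Ind.yoneda (C := C)).obj K) := by
  rw [isFinitelyPresentable_iff_preservesFilteredColimits]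
  let e : coyoneda.obj (op ((Ind.yoneda (C := C)).obj K)) ≅
      Ind.inclusion C ⋙ (evaluation Cᵒᵖ (Type v)).obj (op K) :=
    NatIso.ofComponents (fun X => Equiv.toIso
      (((Ind.inclusion.fullyFaithful (C := C)).homEquiv (X := (Ind.yoneda (C := C)).obj K)).trans
        (((Ind.yonedaCompInclusion.app K).homCongr (Iso.refl _)).trans yonedaEquiv))) (by
      intro X Y f
      ext g
      simp [yonedaEquiv, Functor.FullyFaithful.homEquiv])
  exact ⟨fun J _ _ => preservesColimitsOfShape_of_natIso e.symm⟩

variable {C : Type u} [Category.{v} C]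

attribute [local instance] Cardinal.fact_isRegular_aleph0 Cardinal.orderBotAleph0OrdToType

open MorphismProperty in
/-- The small object argument in ind-objects of `Cᵒᵖ`: every map of pro-objects factors as a map
with the left lifting property against a set of maps between constant pro-objects, followed by a
map with the right lifting property against all such maps. -/
lemma hasFactorization_llp_const [HasColimits (Ind Cᵒᵖ)] {ι : Type} (g : ι → Arrow C) :
    HasFactorization (ofHoms fun i => Pro.const.map (g i).hom).llp
      (ofHoms fun i => Pro.const.map (g i).hom).llp.rlp := by
  let I : MorphismProperty (Ind Cᵒᵖ) := ofHoms fun i => Ind.yoneda.map (g i).hom.op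
  have : IsCardinalForSmallObjectArgument I Cardinal.aleph0.{v} :=
    { isSmall := isSmall_ofHoms _
      preservesColimit := fun {A B X Y} i hi f hf => by
        have : IsFinitelyPresentable.{v} A := by
          obtain ⟨i⟩ := hi
          infer_instance
        infer_instance }
  have : HasSmallObjectArgument.{v} I :=
    ⟨.aleph0, inferInstance, inferInstance, inferInstance⟩
  have hI {X Y : Pro C} (f : X ⟶ Y) :
      (ofHoms fun i => Pro.const.map (g i).hom).llp f ↔ I.rlp f.unop := by
    constructor
    · rintro h _ _ _ ⟨i⟩
      exact (h _ ⟨i⟩).unop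
    · rintro h _ _ _ ⟨i⟩
      exact (h _ ⟨i⟩).op
  refine ⟨fun {X Y} f => ⟨?_⟩⟩
  let F := factorizationData I.rlp.llp I.rlp f.unop
  exact
    { Z := op F.Z
      i := F.p.op
      p := F.i.op
      fac := Quiver.Hom.unop_inj F.fac
      hi := (hI _).2 F.hp
      hp := fun _ _ k hk => (F.hi _ ((hI _).1 hk)).op }

end Factorization

/-! ### Cylinders of pro-objects -/

section Homotopy

variable {C D : Type u} [Category.{v} C] [Category.{v} D] (A : Type u') [AddCommGroup A]

lemma H0.map_eq_of_natTrans {F G : C ⥤ D} (α : F ⟶ G) : H0.map A F = H0.map A G :=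
  AddMonoidHom.ext fun a => Subtype.ext (funext fun x => a.2 (α.app x))

lemma H1.map_eq_of_natTrans {F G : C ⥤ D} (α : F ⟶ G) : H1.map A F = H1.map A G := by
  refine AddMonoidHom.ext fun x => ?_
  obtain ⟨c, rfl⟩ := QuotientAddGroup.mk_surjective x
  -- The values of the cocycle on the components of `α` bound the difference.
  refine QuotientAddGroup.eq.2 ⟨fun x => c.1 _ _ (α.app x), ?_⟩
  refine Subtype.ext (funext fun x => funext fun y => funext fun f => ?_)
  have h₁ := c.2 (F.map f) (α.app y)
  have h₂ := c.2 (α.app x) (G.map f)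
  rw [α.naturality, h₂] at h₁
  change c.1 _ _ (α.app y) - c.1 _ _ (α.app x) = -c.1 _ _ (F.map f) + c.1 _ _ (G.map f)
  rw [sub_eq_iff_eq_add, ← add_right_inj (c.1 _ _ (F.map f)), ← h₁]
  abel

end Homotopy

lemma Pro.exists_cls_of_isColimit {C : Type (w + 1)} [Category.{w} C] {I : Type w}
    [SmallCategory I] [IsFiltered I] {D : I ⥤ Cᵒᵖ} {c : Cocone (D ⋙ Ind.yoneda)}
    (hc : IsColimit c) (F : Cᵒᵖ ⥤ AddCommGrpCat.{w + 1})
    (x : (Pro.extend F).obj (op (op c.pt))) :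
    ∃ (j : I) (a : F.obj (op (D.obj j).unop)),
      Pro.cls F (X := op c.pt) (K := (D.obj j).unop) (c.ι.app j).op a = x := by
  obtain ⟨K, φ, a, rfl⟩ := Pro.exists_cls F x
  obtain ⟨j, q, hq⟩ := IsFinitelyPresentable.exists_hom_of_isColimit hc
    (X := Ind.yoneda.obj (op K)) φ.unop
  obtain ⟨q, rfl⟩ := Ind.yoneda.map_surjective q
  obtain rfl : (c.ι.app j).op ≫ Pro.const.map q.unop = φ := Quiver.Hom.unop_inj hq
  exact ⟨j, F.map q a, (Pro.cls_comp F (K := (D.obj j).unop) _ q.unop a).symm⟩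

section Cylinder

variable (p : ℕ) [NeZero p]

/-- The product of a finite groupoid with the contractible groupoid `ℤ/p // ℤ/p`, which plays the
role of an interval. -/
def cyl : FinGrpd.{w} ⥤ FinGrpd.{w} where
  obj K := ⟨Grpd.of (K.obj × ActionGrpd (Cyc.{w} p) (Cyc.{w} p)), by
    have : Finite (K.obj × ActionGrpd (Cyc.{w} p) (Cyc.{w} p)) := inferInstance
    have (x y : K.obj × ActionGrpd (Cyc.{w} p) (Cyc.{w} p)) : Finite (x ⟶ y) :=
      inferInstanceAs (Finite ((x.1 ⟶ y.1) × (x.2 ⟶ y.2)))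
    exact finite_arrow (K.obj × ActionGrpd (Cyc.{w} p) (Cyc.{w} p))⟩
  map f := FinGrpd.ofFunctor (Functor.prod f.hom (𝟭 _))
  map_id _ := rfl
  map_comp _ _ := rfl

/-- The functor that includes a finite groupoid in its cylinder, at a point of the interval. -/
def cylInclFunctor (s : ActionGrpd (Cyc.{w} p) (Cyc.{w} p)) (K : FinGrpd.{w}) :
    K.obj ⥤ K.obj × ActionGrpd (Cyc.{w} p) (Cyc.{w} p) :=
  Functor.prod' (𝟭 K.obj) ((Functor.const _).obj s)

/-- The inclusion of a finite groupoid in its cylinder, at a point of the interval. -/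
def cylIncl (s : ActionGrpd (Cyc.{w} p) (Cyc.{w} p)) : 𝟭 FinGrpd.{w} ⟶ cyl p where
  app K := FinGrpd.ofFunctor (D := (cyl p).obj K) (cylInclFunctor p s K)
  naturality _ _ _ := rfl

/-- The projection of the cylinder. -/
def cylProj : cyl.{w} p ⟶ 𝟭 FinGrpd.{w} where
  app K := FinGrpd.ofFunctor (C := (cyl p).obj K) (CategoryTheory.Prod.fst K.obj _)
  naturality _ _ _ := rfl

lemma cylIncl_cylProj (s : ActionGrpd (Cyc.{w} p) (Cyc.{w} p)) (K : FinGrpd.{w}) :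
    (cylIncl p s).app K ≫ (cylProj p).app K = 𝟙 K := rfl

/-- The inclusions at two points of the interval are related by a natural transformation. -/
def cylHomotopy (s t : ActionGrpd (Cyc.{w} p) (Cyc.{w} p)) (K : FinGrpd.{w}) :
    cylInclFunctor p s K ⟶ cylInclFunctor p t K :=
  let h : s ⟶ t := ⟨s.pt⁻¹ * t.pt, mul_inv_cancel_left _ _⟩
  NatTrans.prod' (𝟙 (𝟭 K.obj)) ((Functor.const _).map h)

end Cylinder

/-- Every pro-object `W` has a cylinder `T` whose two ends induce the same maps in cohomology and
such that functions can be prescribed independently on the two ends. It is the limit of the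
cylinders of the finite groupoids in a presentation of `W`. -/
lemma exists_cylinder (p : ℕ) [Fact p.Prime] (W : Pro FinGrpd.{w}) :
    ∃ (T : Pro FinGrpd.{w}) (π : T ⟶ W) (i₀ i₁ : W ⟶ T), i₀ ≫ π = 𝟙 W ∧ i₁ ≫ π = 𝟙 W ∧
      (proH0.{w} p).map i₀.op = (proH0.{w} p).map i₁.op ∧
      (proH1.{w} p).map i₀.op = (proH1.{w} p).map i₁.op ∧
      ∀ b : (proC0.{w} p).obj (op W),
        ∃ c, (proC0.{w} p).map i₀.op c = b ∧ (proC0.{w} p).map i₁.op c = 0 := by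
  let D := W.unop.presentation.F
  let c : Cocone (D ⋙ Ind.yoneda) :=
    (colimit.cocone (D ⋙ Ind.yoneda)).extend W.unop.colimitPresentationCompYoneda.hom
  have hc : IsColimit c := IsColimit.extendIso _ (colimit.isColimit _)
  let G := D ⋙ (cyl p).op ⋙ Ind.yoneda
  let ν (s : ActionGrpd (Cyc.{w} p) (Cyc.{w} p)) : G ⟶ D ⋙ Ind.yoneda :=
    { app j := Ind.yoneda.map ((cylIncl p s).app (D.obj j).unop).op
      naturality j k f := by
        dsimp [G]
        rw [← Functor.map_comp, ← Functor.map_comp]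
        rfl }
  let μ : D ⋙ Ind.yoneda ⟶ G :=
    { app j := Ind.yoneda.map ((cylProj p).app (D.obj j).unop).op
      naturality j k f := by
        dsimp [G]
        rw [← Functor.map_comp, ← Functor.map_comp]
        rfl }
  let T : Pro FinGrpd.{w} := op (colimit G)
  let i (s) : W ⟶ T := (IsColimit.map (colimit.isColimit G) c (ν s)).op
  let π : T ⟶ W := (IsColimit.map hc (colimit.cocone G) μ).op
  -- The projections of `W` and `T` to the stages of their presentations.
  let πW (j) : W ⟶ Pro.const.obj (D.obj j).unop := (c.ι.app j).op
  let πT (j) : T ⟶ Pro.const.obj ((cyl p).obj (D.obj j).unop) := (colimit.ι G j).op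
  have hi (s j) : i s ≫ πT j = πW j ≫ Pro.const.map ((cylIncl p s).app (D.obj j).unop) :=
    Quiver.Hom.unop_inj (IsColimit.ι_map (colimit.isColimit G) c (ν s) j)
  have hπ (j) : π ≫ πW j = πT j ≫ Pro.const.map ((cylProj p).app (D.obj j).unop) :=
    Quiver.Hom.unop_inj (IsColimit.ι_map hc (colimit.cocone G) μ j)
  have hiπ (s) : i s ≫ π = 𝟙 W := by
    refine Quiver.Hom.unop_inj (hc.hom_ext fun j => Quiver.Hom.op_inj ?_)
    change (i s ≫ π) ≫ πW j = 𝟙 W ≫ πW j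
    rw [Category.assoc, hπ, ← Category.assoc, hi, Category.assoc, ← Functor.map_comp,
      cylIncl_cylProj, CategoryTheory.Functor.map_id,
      Category.comp_id, Category.id_comp]
  -- An element at a stage of `T` restricts to `W` through the inclusions at that stage.
  have restrict (F : FinGrpd.{w}ᵒᵖ ⥤ AddCommGrpCat.{w + 1}) (s j)
      (a : F.obj (op ((cyl p).obj (D.obj j).unop))) :
      (Pro.extend F).map (i s).op (Pro.cls F (πT j) a) =
        Pro.cls F (πW j) (F.map ((cylIncl p s).app (D.obj j).unop).op a) := by
    rw [Pro.map_cls, hi, Pro.cls_comp]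
  have ends_eq (F : FinGrpd.{w}ᵒᵖ ⥤ AddCommGrpCat.{w + 1}) (s t)
      (hF : ∀ K, F.map ((cylIncl p s).app K).op = F.map ((cylIncl p t).app K).op) :
      (Pro.extend F).map (i s).op = (Pro.extend F).map (i t).op := by
    ext x
    obtain ⟨j, a, rfl⟩ := Pro.exists_cls_of_isColimit (D := D ⋙ (cyl p).op)
      (c := colimit.cocone G) (colimit.isColimit G) F x
    exact (restrict F s j a).trans ((congrArg (fun g => Pro.cls F (πW j) (g a)) (hF _)).trans
      (restrict F t j a).symm)
  let s₀ : ActionGrpd (Cyc.{w} p) (Cyc.{w} p) := ⟨1⟩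
  let s₁ : ActionGrpd (Cyc.{w} p) (Cyc.{w} p) := ⟨⟨Multiplicative.ofAdd 1⟩⟩
  have hs : s₁ ≠ s₀ := fun h => one_ne_zero (α := ZMod p)
    (congrArg (fun s : ActionGrpd (Cyc.{w} p) (Cyc.{w} p) => s.pt.down.toAdd) h)
  refine ⟨T, π, i s₀, i s₁, hiπ _, hiπ _, ends_eq _ _ _ fun K => ?_, ends_eq _ _ _ fun K => ?_,
    fun b => ?_⟩
  · exact congrArg AddCommGrpCat.ofHom (H0.map_eq_of_natTrans _ (cylHomotopy p s₀ s₁ K))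
  · exact congrArg AddCommGrpCat.ofHom (H1.map_eq_of_natTrans _ (cylHomotopy p s₀ s₁ K))
  · classical
    obtain ⟨j, a, rfl⟩ := Pro.exists_cls_of_isColimit hc (C0Fin.{w} (Coeff p)) b
    let a' : (C0Fin.{w} (Coeff p)).obj (op ((cyl p).obj (D.obj j).unop)) :=
      fun x => if x.2 = s₀ then (show (D.obj j).unop.obj → Coeff.{w} p from a) x.1 else 0
    refine ⟨Pro.cls _ (πT j) a', (restrict _ s₀ j a').trans ?_, (restrict _ s₁ j a').trans ?_⟩
    · exact congrArg (Pro.cls (C0Fin.{w} (Coeff p)) (πW j)) (funext fun x => if_pos rfl)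
    · have : (C0Fin.{w} (Coeff p)).map ((cylIncl p s₁).app (D.obj j).unop).op a' = 0 :=
        funext fun x => if_neg hs
      rw [this, map_zero]

/-! ### The model structure -/

section ModelStructure

/-- A map with a section that is a deformation retraction through a cylinder induces isomorphisms
under every functor that identifies the two ends of the cylinder. -/
lemma isIso_map_of_cylinder {C : Type u} [Category.{v} C] {D : Type u'} [Category.{w} D]
    (F : Cᵒᵖ ⥤ D) {W Y T : C} {q : W ⟶ Y} {s : Y ⟶ W} (hs : s ≫ q = 𝟙 Y) {i₀ i₁ : W ⟶ T}
    (H : T ⟶ W) (h₀ : i₀ ≫ H = 𝟙 W) (h₁ : i₁ ≫ H = q ≫ s) (hF : F.map i₀.op = F.map i₁.op) :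
    IsIso (F.map q.op) := by
  refine ⟨F.map s.op, ?_, ?_⟩
  · rw [← F.map_comp, ← op_comp, hs, op_id, F.map_id]
  · rw [← F.map_comp, ← op_comp, ← h₁, op_comp, F.map_comp, ← hF, ← F.map_comp, ← op_comp, h₀,
      op_id, F.map_id]

variable (p : ℕ) [Fact p.Prime]

/-- Every map `f : X ⟶ Y` factors through the product of `Y` and of copies of `ℤ/p // ℤ/p` indexed
by the maps from `X` to `ℤ/p // ℤ/p`: the first map is tautologically a cofibration, and the
projection to `Y` is homotopically trivial because `ℤ/p // ℤ/p` is contractible. -/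
lemma exists_factorization {X Y : Pro FinGrpd.{w}} (f : X ⟶ Y) :
    ∃ (W : Pro FinGrpd.{w}) (i : X ⟶ W) (q : W ⟶ Y), i ≫ q = f ∧ cofib p i ∧
      (cofib p).rlp q ∧ IsCohomologyIso p q := by
  let E : Pro FinGrpd.{w} := Pro.const.obj (cycModCyc p)
  have hE (Z : Pro FinGrpd.{w}) := (isUniversal_universalC0.{w} p).cls_bijective Z
  let W := Y ⨯ ∏ᶜ fun _ : X ⟶ E => E
  let q : W ⟶ Y := prod.fst
  let pr (t : X ⟶ E) : W ⟶ E := prod.snd ≫ Pi.π _ t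
  have hom_ext {Z : Pro FinGrpd.{w}} {a b : Z ⟶ W} (h : a ≫ q = b ≫ q)
      (h' : ∀ t, a ≫ pr t = b ≫ pr t) : a = b :=
    Limits.prod.hom_ext h (Pi.hom_ext _ _ fun t => by simpa only [pr, Category.assoc] using h' t)
  have exists_hom {Z : Pro FinGrpd.{w}} (a : Z ⟶ Y) (b : (X ⟶ E) → (Z ⟶ E)) :
      ∃ l : Z ⟶ W, l ≫ q = a ∧ ∀ t, l ≫ pr t = b t :=
    ⟨prod.lift a (Pi.lift b), prod.lift_fst _ _, fun t =>
      (prod.lift_snd_assoc _ _ _).trans (limit.lift_π _ _)⟩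
  obtain ⟨i, hi, hi'⟩ := exists_hom f id
  refine ⟨W, i, q, hi, ⟨fun {φ g} sq => ?_⟩, fun A B h hh => ⟨fun {a b} sq => ?_⟩, ?_⟩
  · obtain ⟨uW⟩ := Pro.nonempty_unique_hom_point W
    exact ⟨⟨⟨pr φ, hi' φ, Subsingleton.elim _ _⟩⟩⟩
  · obtain ⟨uA⟩ := Pro.nonempty_unique_hom_point A
    obtain ⟨uB⟩ := Pro.nonempty_unique_hom_point B
    have (t : X ⟶ E) : ∃ l : B ⟶ E, h ≫ l = a ≫ pr t := by
      have : HasLiftingProperty h _ := hh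
      have sq : CommSq (a ≫ pr t) h (Pro.const.map (toPoint (cycModCyc p))) default :=
        ⟨Subsingleton.elim _ _⟩
      exact ⟨sq.lift, sq.fac_left⟩
    choose l hl using this
    obtain ⟨k, hk, hk'⟩ := exists_hom b l
    exact ⟨⟨⟨k, hom_ext (by rw [Category.assoc, hk, sq.w])
      fun t => by rw [Category.assoc, hk', hl], hk⟩⟩⟩
  · -- The projection from `W` is a homotopy equivalence: each factor contracts on its base point.
    obtain ⟨T, π, i₀, i₁, hi₀, hi₁, eq_H0, eq_H1, hT⟩ := exists_cylinder p W
    obtain ⟨ζ, hζ⟩ := (hE Y).2 0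
    obtain ⟨s, hs, hs'⟩ := exists_hom (𝟙 Y) fun _ => ζ
    have (t : X ⟶ E) : ∃ l : T ⟶ E, i₀ ≫ l = pr t ∧ i₁ ≫ l = q ≫ ζ := by
      obtain ⟨c, hc₀, hc₁⟩ := hT (Pro.cls _ (pr t) (universalC0 p))
      obtain ⟨l, rfl⟩ := (hE T).2 c
      refine ⟨l, (hE W).1 ((Pro.map_cls _ _ _ _).symm.trans hc₀), (hE W).1 ?_⟩
      refine (Pro.map_cls _ _ _ _).symm.trans (hc₁.trans ?_)
      refine Eq.trans ?_ (Pro.map_cls _ q ζ (universalC0 p))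
      exact (map_zero ((proC0.{w} p).map q.op).hom).symm.trans
        (congrArg ((proC0.{w} p).map q.op) hζ.symm)
    choose l hl₀ hl₁ using this
    obtain ⟨H, hH, hH'⟩ := exists_hom (π ≫ q) l
    have h₀ : i₀ ≫ H = 𝟙 W := hom_ext
      (by rw [Category.assoc, hH, ← Category.assoc, hi₀])
      fun t => by rw [Category.assoc, hH', hl₀, Category.id_comp]
    have h₁ : i₁ ≫ H = q ≫ s := hom_ext
      (by rw [Category.assoc, hH, ← Category.assoc, hi₁, Category.assoc, hs, Category.id_comp,
        Category.comp_id])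
      fun t => by rw [Category.assoc, hH', hl₁, Category.assoc, hs']
    exact ⟨isIso_map_of_cylinder _ hs H h₀ h₁ eq_H0, isIso_map_of_cylinder _ hs H h₀ h₁ eq_H1⟩

lemma isCohomologyIso_eq (p : ℕ) : IsCohomologyIso.{w} p =
    (MorphismProperty.isomorphisms _).inverseImage (proH0.{w} p).rightOp ⊓
      (MorphismProperty.isomorphisms _).inverseImage (proH1.{w} p).rightOp := by
  ext X Y f
  exact and_congr (isIso_op_iff ((proH0.{w} p).map f.op)).symm
    (isIso_op_iff ((proH1.{w} p).map f.op)).symm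

instance (p : ℕ) : (IsCohomologyIso.{w} p).HasTwoOutOfThreeProperty := by
  rw [isCohomologyIso_eq]
  infer_instance

instance (p : ℕ) : (IsCohomologyIso.{w} p).IsStableUnderRetracts := by
  rw [isCohomologyIso_eq]
  infer_instance

/-- The maps of finite groupoids that detect the trivial cofibrations by lifting. -/
def generators (p : ℕ) [NeZero p] : Fin 3 → Arrow FinGrpd.{w} :=
  ![Arrow.mk (cycModCycToPointModCyc p), Arrow.mk (toPoint (pointModCyc p)),
    Arrow.mk (pointToDiscreteCyc p)]

open MorphismProperty

lemma cofib_eq_llp : cofib.{w} p =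
    (ofHoms fun _ : Unit => Pro.const.map (toPoint (cycModCyc.{w} p))).llp := by
  ext X Y f
  exact ⟨by rintro h _ _ _ ⟨_⟩; exact h, fun h => h _ ⟨()⟩⟩

lemma cofib_inf_isCohomologyIso_eq_llp : cofib.{w} p ⊓ IsCohomologyIso p =
    (ofHoms fun j => Pro.const.map (generators.{w} p j).hom).llp := by
  ext X Y f
  refine (cofib_and_isCohomologyIso_iff p f).trans ⟨?_, fun h => ⟨h _ ⟨0⟩, h _ ⟨1⟩, h _ ⟨2⟩⟩⟩
  rintro ⟨h₀, h₁, h₂⟩ _ _ _ ⟨j⟩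
  fin_cases j
  exacts [h₀, h₁, h₂]

/-- The fibrations: the maps with the right lifting property against the trivial cofibrations. -/
def fib (p : ℕ) [NeZero p] : MorphismProperty (Pro FinGrpd.{w}) :=
  (cofib p ⊓ IsCohomologyIso p).rlp

instance : IsWeakFactorizationSystem (cofib.{w} p ⊓ IsCohomologyIso p) (fib p) where
  rlp := rfl
  llp := by rw [fib, cofib_inf_isCohomologyIso_eq_llp, llp_rlp_llp]
  hasFactorization := by
    rw [fib, cofib_inf_isCohomologyIso_eq_llp]
    exact hasFactorization_llp_const _

/-- The maps with the right lifting property against the cofibrations are the fibrations that are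
isomorphisms in cohomology, by the retract argument for the factorization above. -/
lemma rlp_cofib : (cofib.{w} p).rlp = fib p ⊓ IsCohomologyIso p := by
  ext X Y f
  obtain ⟨W, i, q, fac, hi, hq, hq'⟩ := exists_factorization p f
  constructor
  · intro hf
    refine ⟨antitone_rlp inf_le_left _ hf, ?_⟩
    have : HasLiftingProperty i f := hf _ hi
    exact of_retract (RetractArrow.ofRightLiftingProperty fac) hq'
  · rintro ⟨hf, hf'⟩
    have hi' : IsCohomologyIso p i := of_postcomp _ i q hq' (by rwa [fac])
    have : HasLiftingProperty i f := hf _ ⟨hi, hi'⟩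
    exact of_retract (RetractArrow.ofRightLiftingProperty fac) hq

instance : IsWeakFactorizationSystem (cofib.{w} p) (fib p ⊓ IsCohomologyIso p) where
  rlp := rlp_cofib p
  llp := by rw [← rlp_cofib, cofib_eq_llp, llp_rlp_llp]
  hasFactorization := by
    rw [← rlp_cofib]
    refine ⟨fun f => ?_⟩
    obtain ⟨W, i, q, fac, hi, hq, -⟩ := exists_factorization p f
    exact ⟨⟨W, i, q, fac, hi, hq⟩⟩

/-- The model structure whose cofibrations are `cofib p` and whose weak equivalences are the
isomorphisms on `H⁰` and `H¹`. -/
@[reducible]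
noncomputable def modelCategory : ModelCategory (Pro FinGrpd.{w}) :=
  letI : CategoryWithCofibrations (Pro FinGrpd.{w}) := ⟨cofib p⟩
  letI : CategoryWithFibrations (Pro FinGrpd.{w}) := ⟨fib p⟩
  letI : CategoryWithWeakEquivalences (Pro FinGrpd.{w}) := ⟨IsCohomologyIso p⟩
  haveI : (weakEquivalences (Pro FinGrpd.{w})).HasTwoOutOfThreeProperty :=
    inferInstanceAs (IsCohomologyIso.{w} p).HasTwoOutOfThreeProperty
  haveI : IsWeakFactorizationSystem (cofibrations (Pro FinGrpd.{w}))
      (trivialFibrations (Pro FinGrpd.{w})) :=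
    inferInstanceAs (IsWeakFactorizationSystem (cofib.{w} p) (fib p ⊓ IsCohomologyIso p))
  haveI : IsWeakFactorizationSystem (trivialCofibrations (Pro FinGrpd.{w}))
      (fibrations (Pro FinGrpd.{w})) :=
    inferInstanceAs (IsWeakFactorizationSystem (cofib.{w} p ⊓ IsCohomologyIso p) (fib p))
  ModelCategory.mk' _

end ModelStructure

end ProGrpd

theorem mainTheorem9 (p : ℕ) [Fact p.Prime] :
    Limits.HasLimitsOfSize.{w, w} (ProGrpd.Pro ProGrpd.FinGrpd.{w}) ∧
    Limits.HasColimitsOfSize.{w, w} (ProGrpd.Pro ProGrpd.FinGrpd.{w}) ∧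
    ∃ _ : ModelCategory (ProGrpd.Pro ProGrpd.FinGrpd.{w}),
      ∀ ⦃C D : ProGrpd.Pro ProGrpd.FinGrpd.{w}⦄ (f : C ⟶ D),
        (Cofibration f ↔
          HasLiftingProperty f
            (ProGrpd.Pro.const.map (ProGrpd.toPoint (ProGrpd.cycModCyc.{w} p)))) ∧
        ((Cofibration f ∧ WeakEquivalence f) ↔
          HasLiftingProperty f
            (ProGrpd.Pro.const.map (ProGrpd.cycModCycToPointModCyc.{w} p)) ∧
          HasLiftingProperty f
            (ProGrpd.Pro.const.map (ProGrpd.toPoint (ProGrpd.pointModCyc.{w} p))) ∧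
          HasLiftingProperty f
            (ProGrpd.Pro.const.map (ProGrpd.pointToDiscreteCyc.{w} p))) ∧
        (WeakEquivalence f ↔
          IsIso ((ProGrpd.proH0.{w} p).map f.op) ∧
          IsIso ((ProGrpd.proH1.{w} p).map f.op)) := by
  refine ⟨inferInstance, inferInstance, ProGrpd.modelCategory p, fun C D f => ?_⟩
  let := ProGrpd.modelCategory.{w} p
  have hcof : Cofibration f ↔ ProGrpd.cofib p f := cofibration_iff f
  have hweq : WeakEquivalence f ↔ ProGrpd.IsCohomologyIso p f := weakEquivalence_iff f
  exact ⟨hcof, (and_congr hcof hweq).trans (ProGrpd.cofib_and_isCohomologyIso_iff p f), hweq⟩
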